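/- **Setting.** Let $\mathcal A\subset\mathbb R^d$ be a finite set whose convex hull $\Delta$ has non-empty interior. A *patch* is a family $\beta=\{\beta_{\mathbf a}\mid \mathbf a\in\mathcal A\}$ of continuous (for example $C^\infty$) non-negative functions $\beta_{\mathbf a}\colon\Delta\to\mathbb R$ without a common zero on $\Delta$; its normalized blending functions are $\bar\beta_{\mathbf a}=\beta_{\mathbf a}/\sum_{\mathbf c\in\mathcal A}\beta_{\mathbf c}$. Reparametrizing $\beta$ by a homeomorphism $\psi\colon\Delta\to\Delta$ gives the patch $\{\beta_{\mathbf a}\circ\psi\}$. The patch has *linear precision* if $\Lambda(x)=\sum_{\mathbf a}\bar\beta_{\mathbf a}(x)\Lambda(\mathbf a)$ on $\Delta$ for every affine function $\Lambda$ on $\mathbb R^d$, and it is *proper* if the tautological map $\tau(x)=\sum_{\mathbf a}\bar\beta_{\mathbf a}(x)\,\mathbf a$ is a homeomorphism $\Delta\to\Delta$. It has *rational linear precision* if it is proper and its (unique) reparametrization having linear precision has normalized blending functions that are rational functions, where a function $f$ on $\Delta$ is *rational* if there are real polynomials $p$ and $q\neq 0$ with $qf=p$ on $\Delta$. A *polynomial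 parametrization* of the patch is a family $b=\{b_{\mathbf a}\mid\mathbf a\in\mathcal A\}$ of real polynomials in $d$ variables such that, for some homeomorphism $\psi$ of $\Delta$ and some non-zero real polynomial $q$, $b_{\mathbf a}(x)=q(x)\,\bar\beta_{\mathbf a}(\psi(x))$ for all $x\in\Delta$ and $\mathbf a\in\mathcal A$. Given $b$, let $Y_\beta\subset\mathbb{CP}^{\mathcal A}$ be the Zariski closure of the image of the map $\mathbb C^d\dashrightarrow\mathbb{CP}^{\mathcal A}$, $t\mapsto[b_{\mathbf a}(t)\mid\mathbf a\in\mathcal A]$, defined where the $b_{\mathbf a}$ do not all vanish. The tautological projection $\pi_{\mathcal A}\colon\mathbb{CP}^{\mathcal A}\dashrightarrow\mathbb{CP}^d$ is $[y_{\mathbf a}]\mapsto\bigl[\sum_{\mathbf a}y_{\mathbf a}(1,\mathbf a)\bigr]$, and its center $E_{\mathcal A}$ is the linear subspace of $\mathbb{CP}^{\mathcal A}$ where $\sum_{\mathbf a}y_{\mathbf a}(1,\mathbf a)=0$. **Theorem.** Suppose that a patch $\beta$ has rational linear precision. Then it has a polynomial parametrization, and for every polynomial parametrization of it: 1. $Y_\beta$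 is a rational variety of dimension $d$, that is, an irreducible projective variety birational to $\mathbb C^d$. 2. Almost all planes $L\subset\mathbb{CP}^{\mathcal A}$ of codimension $d$ that contain $E_{\mathcal A}$ meet $Y_\beta$ in at most one point outside of $E_{\mathcal A}$. Here these planes are parametrized by the points of $\mathbb{CP}^d$ through $L\mapsto\pi_{\mathcal A}(L\setminus E_{\mathcal A})$, and "almost all" means all those in some non-empty Zariski open subset of $\mathbb{CP}^d$. -/

import Mathlib

open scoped BigOperators LinearAlgebra.Projectivization

noncomputable section

/-! ### Parametric patches -/

/-- The domain polytope `Δ`: the convex hull of `𝒜`. -/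
abbrev DomainPolytope {d : ℕ} (A : Finset (Fin d → ℝ)) : Set (Fin d → ℝ) :=
  convexHull ℝ (A : Set (Fin d → ℝ))

/-- A parametric patch: non-negative blending functions on `Δ`, indexed by `𝒜`, without common
zeros on `Δ`, where `Δ` is full dimensional.  Only continuity of the blending functions is
required (smooth ones are a special case), so that every reparametrization by a homeomorphism of
`Δ` is again a patch. -/
structure Patch {d : ℕ} (A : Finset (Fin d → ℝ)) where
  /-- the blending functions -/
  blend : A → DomainPolytope A → ℝ
  continuous_blend : ∀ a, Continuous (blend a)
  nonneg : ∀ a x, 0 ≤ blend a x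
  no_base_points : ∀ x, ∃ a, blend a x ≠ 0
  full_dim : (interior (DomainPolytope A)).Nonempty

namespace Patch

variable {d : ℕ} {A : Finset (Fin d → ℝ)}

/-- The normalized blending functions. -/
def normalized (P : Patch A) (a : A) (x : DomainPolytope A) : ℝ :=
  P.blend a x / ∑ c, P.blend c x

/-- The map `F : Δ → E` given by control points `b`. -/
def toMap {E : Type*} [AddCommGroup E] [Module ℝ E] (P : Patch A) (b : A → E)
    (x : DomainPolytope A) : E :=
  ∑ a, P.normalized a x • b a

/-- The tautological map `τ`, with control points the points of `𝒜`. -/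
def taut (P : Patch A) : DomainPolytope A → (Fin d → ℝ) :=
  P.toMap (fun a => (a : Fin d → ℝ))

/-- Linear precision: the patch replicates affine functions. -/
def HasLinearPrecision (P : Patch A) : Prop :=
  ∀ (Λ : (Fin d → ℝ) →ᵃ[ℝ] ℝ) (x : DomainPolytope A),
    Λ (x : Fin d → ℝ) = P.toMap (fun a => Λ (a : Fin d → ℝ)) x

/-- The reparametrization of a patch by a homeomorphism of `Δ`. -/
def reparam (P : Patch A) (ψ : DomainPolytope A ≃ₜ DomainPolytope A) : Patch A where
  blend a x := P.blend a (ψ x)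
  continuous_blend a := (P.continuous_blend a).comp ψ.continuous
  nonneg a x := P.nonneg a (ψ x)
  no_base_points x := P.no_base_points (ψ x)
  full_dim := P.full_dim

/-- A patch is proper if its tautological map is a homeomorphism of `Δ`. -/
def IsProper (P : Patch A) : Prop :=
  ∃ h : DomainPolytope A ≃ₜ DomainPolytope A, ∀ x, (h x : Fin d → ℝ) = P.taut x

end Patch

/-- A function on `Δ` is rational if it is a quotient `p / q` of real polynomials, `q ≠ 0`.  Written
without division, so that `q` may vanish at some points of `Δ`; as `Δ` is full dimensional, a
continuous function on `Δ` is determined by its values where `q` does not vanish. -/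
def IsRationalFunction {d : ℕ} {A : Finset (Fin d → ℝ)} (f : DomainPolytope A → ℝ) : Prop :=
  ∃ p q : MvPolynomial (Fin d) ℝ, q ≠ 0 ∧
    ∀ x : DomainPolytope A,
      MvPolynomial.eval (x : Fin d → ℝ) q * f x = MvPolynomial.eval (x : Fin d → ℝ) p

namespace Patch

variable {d : ℕ} {A : Finset (Fin d → ℝ)}

/-- Rational linear precision: the patch is proper and its (unique) reparametrization having linear
precision has rational (normalized) blending functions. -/
def HasRationalLinearPrecision (P : Patch A) : Prop :=
  P.IsProper ∧ ∃ ψ : DomainPolytope A ≃ₜ DomainPolytope A,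
    (P.reparam ψ).HasLinearPrecision ∧ ∀ a, IsRationalFunction ((P.reparam ψ).normalized a)

/-- `b` is a polynomial parametrization of the patch: the polynomials `b a` arise from a
reparametrization with rational normalized blending functions by clearing denominators, that is,
by multiplying these functions by a common nonzero polynomial `q`. -/
def IsPolynomialParametrization (P : Patch A) (b : A → MvPolynomial (Fin d) ℝ) : Prop :=
  ∃ ψ : DomainPolytope A ≃ₜ DomainPolytope A, ∃ q : MvPolynomial (Fin d) ℝ, q ≠ 0 ∧
    ∀ (a : A) (x : DomainPolytope A),
      MvPolynomial.eval (x : Fin d → ℝ) (b a) =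
        MvPolynomial.eval (x : Fin d → ℝ) q * (P.reparam ψ).normalized a x

end Patch

/-! ### Complex projective sets and rational varieties -/

/-- Complex projective space with coordinates indexed by `σ`. -/
abbrev CP (σ : Type*) := ℙ ℂ (σ → ℂ)

/-- The homogeneous polynomial `f` vanishes at `y` (independent of the representative of `y`). -/
def VanishesAt {σ : Type*} (f : MvPolynomial σ ℂ) (y : CP σ) : Prop :=
  MvPolynomial.eval y.rep f = 0

/-- The Zariski closure of a subset of projective space. -/
def zariskiClosure {σ : Type*} (S : Set (CP σ)) : Set (CP σ) :=
  {y | ∀ (n : ℕ) (f : MvPolynomial σ ℂ), f.IsHomogeneous n →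
    (∀ s ∈ S, VanishesAt f s) → VanishesAt f y}

/-- Zariski closed subsets of projective space. -/
def IsZariskiClosed {σ : Type*} (Z : Set (CP σ)) : Prop :=
  zariskiClosure Z = Z

/-- (Irreducible) projective varieties. -/
structure IsProjectiveVariety {σ : Type*} (Y : Set (CP σ)) : Prop where
  nonempty : Y.Nonempty
  closed : IsZariskiClosed Y
  irreducible : ∀ Z₁ Z₂ : Set (CP σ), IsZariskiClosed Z₁ → IsZariskiClosed Z₂ →
    Y ⊆ Z₁ ∪ Z₂ → Y ⊆ Z₁ ∨ Y ⊆ Z₂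

/-- A rational map `Y ⇢ ℂ^d`, given by quotients of homogeneous polynomials of equal degree. -/
structure RationalMapToAffine {σ : Type*} (Y : Set (CP σ)) (d : ℕ) where
  degree : ℕ
  num : Fin d → MvPolynomial σ ℂ
  den : MvPolynomial σ ℂ
  num_homogeneous : ∀ i, (num i).IsHomogeneous degree
  den_homogeneous : den.IsHomogeneous degree
  exists_den_ne_zero : ∃ y ∈ Y, ¬ VanishesAt den y

namespace RationalMapToAffine

variable {σ : Type*} {Y : Set (CP σ)} {d : ℕ}

/-- The open subset of `Y` where the map is defined. -/
def domain (φ : RationalMapToAffine Y d) : Set (CP σ) :=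
  {y ∈ Y | ¬ VanishesAt φ.den y}

/-- The value of the map at a point of its domain. -/
def value (φ : RationalMapToAffine Y d) (y : CP σ) : Fin d → ℂ :=
  fun i => MvPolynomial.eval y.rep (φ.num i) / MvPolynomial.eval y.rep φ.den

end RationalMapToAffine

/-- A rational map `ℂ^d ⇢ Y`, given by polynomials. -/
structure RationalMapFromAffine (d : ℕ) {σ : Type*} (Y : Set (CP σ)) where
  coord : σ → MvPolynomial (Fin d) ℂ
  exists_ne_zero : ∃ t : Fin d → ℂ, (fun a => MvPolynomial.eval t (coord a)) ≠ 0
  mem : ∀ (t : Fin d → ℂ) (ht : (fun a => MvPolynomial.eval t (coord a)) ≠ 0),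
    Projectivization.mk ℂ (fun a => MvPolynomial.eval t (coord a)) ht ∈ Y

namespace RationalMapFromAffine

variable {σ : Type*} {Y : Set (CP σ)} {d : ℕ}

/-- The open subset of `ℂ^d` where the map is defined. -/
def domain (γ : RationalMapFromAffine d Y) : Set (Fin d → ℂ) :=
  {t | (fun a => MvPolynomial.eval t (γ.coord a)) ≠ 0}

/-- The value of the map at a point of its domain. -/
def value (γ : RationalMapFromAffine d Y) (t : Fin d → ℂ) (ht : t ∈ γ.domain) : CP σ :=
  Projectivization.mk ℂ (fun a => MvPolynomial.eval t (γ.coord a)) ht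

end RationalMapFromAffine

/-- `Y` is a rational variety of dimension `d`: a projective variety birational to `ℂ^d`.  Both
compositions of the two rational maps are defined somewhere (hence on a dense open set, by
irreducibility) and are the identity wherever they are defined. -/
def IsRationalVariety {σ : Type*} (d : ℕ) (Y : Set (CP σ)) : Prop :=
  IsProjectiveVariety Y ∧
    ∃ (φ : RationalMapToAffine Y d) (γ : RationalMapFromAffine d Y),
      (∃ y ∈ φ.domain, φ.value y ∈ γ.domain) ∧
      (∀ y ∈ φ.domain, ∀ h : φ.value y ∈ γ.domain, γ.value (φ.value y) h = y) ∧
      (∃ (t : Fin d → ℂ) (ht : t ∈ γ.domain), γ.value t ht ∈ φ.domain) ∧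
      (∀ (t : Fin d → ℂ) (ht : t ∈ γ.domain), γ.value t ht ∈ φ.domain →
        φ.value (γ.value t ht) = t)

/-! ### The variety of a patch and the tautological projection -/

section Geometry

variable {d : ℕ} {A : Finset (Fin d → ℝ)}

/-- The image of the map `ℂ^d ⇢ ℂℙ^𝒜` given by the polynomials `b`, defined off their common
zeros. -/
def complexImage (b : A → MvPolynomial (Fin d) ℝ) : Set (CP A) :=
  {y | ∃ (t : Fin d → ℂ) (ht : (fun a => MvPolynomial.aeval t (b a) : A → ℂ) ≠ 0),
    y = Projectivization.mk ℂ (fun a => MvPolynomial.aeval t (b a) : A → ℂ) ht}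

/-- `Y_β`: the Zariski closure of the image of the polynomial parametrization. -/
def patchVariety (b : A → MvPolynomial (Fin d) ℝ) : Set (CP A) :=
  zariskiClosure (complexImage b)

/-- The linear map `y ↦ ∑ y_a (1, a)` from `ℂ^𝒜` to `ℂ^(d+1)` that defines the complexified
tautological projection. -/
def tautLinear (A : Finset (Fin d → ℝ)) : (A → ℂ) →ₗ[ℂ] (Fin (d + 1) → ℂ) :=
  ∑ a : A, (LinearMap.proj a : (A → ℂ) →ₗ[ℂ] ℂ).smulRight
    (Fin.cons 1 (fun i => (((a : Fin d → ℝ) i : ℝ) : ℂ)) : Fin (d + 1) → ℂ)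

/-- The linear subspace of `ℂ^𝒜` whose projectivization is the center `E_𝒜`. -/
def center (A : Finset (Fin d → ℝ)) : Submodule ℂ (A → ℂ) :=
  LinearMap.ker (tautLinear A)

/-- `Q` holds for almost all planes of codimension `d` in `ℂℙ^𝒜` containing the center.  Such a
plane is given by a linear subspace `W` of `ℂ^𝒜`, and these planes are parametrized by the points
of `ℂℙ^d` through `W ↦ tautLinear A '' W` (a line in `ℂ^(d+1)`).  "Almost all" means: for all
planes in a nonempty Zariski open subset of this parameter space. -/
def ForAlmostAllPlanes (A : Finset (Fin d → ℝ)) (Q : Submodule ℂ (A → ℂ) → Prop) : Prop :=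
  ∃ (n : ℕ) (h : MvPolynomial (Fin (d + 1)) ℂ), h.IsHomogeneous n ∧ h ≠ 0 ∧
    ∀ W : Submodule ℂ (A → ℂ), center A ≤ W → Module.finrank ℂ W + d = A.card →
      (∃ w ∈ W, w ∉ center A ∧ MvPolynomial.eval (tautLinear A w) h ≠ 0) → Q W

end Geometry

end

/-! Take the reparametrization with linear precision and clear denominators: `c a` is `q` times the
blending function. Linear precision becomes `∑ c_a (1, a) = q · (1, x)` on `Δ`, hence an identity of
polynomials, since `Δ` has interior, and it holds at all complex `t`
(`HasLinearPrecision.hasComplexLinearPrecision`). So the tautological projection inverts the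
parametrization. Homogenizing `c` and composing with the projection gives forms `g a` for which `g a
· y_c = g c · y_a` holds on the image, hence on its closure. A point of `Y` off the center is
therefore determined by its projection `[1, t]` as soon as `c(t) ≠ 0`
(`eq_mk_of_tautLinear_rep_eq`). This gives birationality, and also the second claim, because a plane
of codimension `d` through the center projects to one point. Irreducibility holds because `ℂ[t]` is
a domain. An arbitrary polynomial parametrization has the same closure, since the forms vanishing on
its image are those vanishing on the normalized blending functions (`patchVariety_eq`). -/

/-! ### Homogenization, and polynomials vanishing on open sets of real points. -/

namespace MvPolynomial

/-- Scaling the argument of a homogeneous polynomial. -/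
theorem IsHomogeneous.eval_smul {σ R : Type*} [CommSemiring R] {p : MvPolynomial σ R} {n : ℕ}
    (hp : p.IsHomogeneous n) (c : R) (v : σ → R) : eval (c • v) p = c ^ n * eval v p := by
  rw [eval_eq, eval_eq, Finset.mul_sum]
  refine Finset.sum_congr rfl fun m hm => ?_
  have hdeg : ∑ i ∈ m.support, m i = n := (hp.degree_eq_sum_deg_support hm).symm
  simp only [Pi.smul_apply, smul_eq_mul, mul_pow, Finset.prod_mul_distrib,
    Finset.prod_pow_eq_pow_sum, hdeg]
  ring

/-- The homogenization of degree `N` of a polynomial, with the new variable in position `0`. -/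
noncomputable def homogenizeCons {R : Type*} [CommSemiring R] {d : ℕ} (N : ℕ)
    (p : MvPolynomial (Fin d) R) : MvPolynomial (Fin (d + 1)) R :=
  ∑ k ∈ Finset.range (N + 1), X 0 ^ (N - k) * rename Fin.succ (homogeneousComponent k p)

theorem homogenizeCons_isHomogeneous {R : Type*} [CommSemiring R] {d : ℕ} (N : ℕ)
    (p : MvPolynomial (Fin d) R) : (homogenizeCons N p).IsHomogeneous N := by
  refine IsHomogeneous.sum _ _ _ fun k hk => ?_
  have h := (isHomogeneous_X_pow (R := R) (0 : Fin (d + 1)) (N - k)).mul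
    ((homogeneousComponent_isHomogeneous k p).rename_isHomogeneous (f := Fin.succ))
  rwa [Nat.sub_add_cancel (Nat.lt_succ_iff.mp (Finset.mem_range.mp hk))] at h

/-- Homogeneity supplies the factor `s ^ N`, leaving `s = 1`; there the bound `hp` ensures that
cutting off at degree `N` loses no component. -/
theorem eval_homogenizeCons {R : Type*} [CommSemiring R] {d N : ℕ}
    {p : MvPolynomial (Fin d) R} (hp : p.totalDegree ≤ N) (s : R) (t : Fin d → R) :
    eval (s • (Fin.cons 1 t : Fin (d + 1) → R)) (homogenizeCons N p) = s ^ N * eval t p := by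
  rw [(homogenizeCons_isHomogeneous N p).eval_smul]
  congr 1
  have hsum : ∑ k ∈ Finset.range (N + 1), homogeneousComponent k p = p := by
    conv_rhs => rw [← sum_homogeneousComponent p]
    refine (Finset.sum_subset (Finset.range_mono (by omega)) fun k _ hk => ?_).symm
    exact homogeneousComponent_eq_zero _ _ (by simpa using hk)
  conv_rhs => rw [← hsum]
  simp only [homogenizeCons, map_sum, map_mul, map_pow, eval_X, Fin.cons_zero, one_pow, one_mul,
    eval_rename]
  rfl

/-- A complex polynomial that vanishes at the points of a nonempty open subset of `ℝ^d` is zero. -/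
theorem eq_zero_of_eval_ofReal_eq_zero {d : ℕ} {U : Set (Fin d → ℝ)} (hU : IsOpen U)
    (hne : U.Nonempty) {p : MvPolynomial (Fin d) ℂ}
    (h : ∀ x ∈ U, eval (fun i => (x i : ℂ)) p = 0) : p = 0 := by
  obtain ⟨x, hx⟩ := hne
  obtain ⟨ε, hε, hball⟩ := Metric.isOpen_iff.mp hU x hx
  -- A ball for the sup metric is a product of intervals, and a polynomial vanishing on a product of
  -- infinite sets is zero.
  refine funext_set (fun i => Complex.ofReal '' Metric.ball (x i) ε) (fun i => ?_) fun z hz => ?_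
  · refine Set.Infinite.image Complex.ofReal_injective.injOn ?_
    rw [Real.ball_eq_Ioo]
    exact Set.Ioo_infinite (by linarith)
  · choose y hy hyz using fun i => hz i (Set.mem_univ i)
    obtain rfl : (fun i => (y i : ℂ)) = z := _root_.funext hyz
    rw [map_zero]
    refine h y (hball ?_)
    rw [ball_pi x hε]
    exact fun i _ => hy i

theorem aeval_ofReal {d : ℕ} (p : MvPolynomial (Fin d) ℝ) (x : Fin d → ℝ) :
    aeval (fun i => (x i : ℂ)) p = ((eval x p : ℝ) : ℂ) := by
  rw [← Complex.coe_algebraMap]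
  exact aeval_algebraMap_apply ℂ x p

theorem eval_map_ofReal {d : ℕ} (p : MvPolynomial (Fin d) ℝ) (t : Fin d → ℂ) :
    eval t (map (algebraMap ℝ ℂ) p) = aeval t p := by
  rw [eval_map, aeval_def]

/-- A real polynomial that vanishes on a nonempty open subset of `ℝ^d` is zero. -/
theorem eq_zero_of_eval_eq_zero_of_isOpen {d : ℕ} {U : Set (Fin d → ℝ)} (hU : IsOpen U)
    (hne : U.Nonempty) {p : MvPolynomial (Fin d) ℝ} (h : ∀ x ∈ U, eval x p = 0) : p = 0 := by
  refine map_injective (algebraMap ℝ ℂ) (algebraMap ℝ ℂ).injective ?_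
  rw [map_zero]
  refine eq_zero_of_eval_ofReal_eq_zero hU hne fun x hx => ?_
  rw [eval_map_ofReal, aeval_ofReal, h x hx, Complex.ofReal_zero]

end MvPolynomial

/-! ### Vanishing and Zariski closure in projective space. -/

section ProjectiveSets

variable {σ : Type*}

theorem vanishesAt_mk {f : MvPolynomial σ ℂ} {n : ℕ} (hf : f.IsHomogeneous n) {v : σ → ℂ}
    (hv : v ≠ 0) : VanishesAt f (Projectivization.mk ℂ v hv) ↔ MvPolynomial.eval v f = 0 := by
  obtain ⟨c, hc⟩ := Projectivization.exists_smul_eq_mk_rep ℂ v hv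
  rw [VanishesAt, ← hc, Units.smul_def, hf.eval_smul]
  simp

theorem subset_zariskiClosure (S : Set (CP σ)) : S ⊆ zariskiClosure S :=
  fun y hy _ _ _ h => h y hy

theorem isZariskiClosed_zariskiClosure (S : Set (CP σ)) : IsZariskiClosed (zariskiClosure S) :=
  (subset_zariskiClosure _).antisymm' fun _ hy n f hf h => hy n f hf fun _ hs => hs n f hf h

/-- A point whose coordinates are proportional to those of `v`. -/
theorem eq_mk_of_mul_rep_eq {v : σ → ℂ} (hv : v ≠ 0) {y : CP σ}
    (h : ∀ a c, v a * y.rep c = v c * y.rep a) : y = Projectivization.mk ℂ v hv := by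
  obtain ⟨a, ha⟩ := Function.ne_iff.mp hv
  rw [← y.mk_rep, Projectivization.mk_eq_mk_iff']
  refine ⟨y.rep a / v a, funext fun c => ?_⟩
  have := h a c
  simp only [Pi.smul_apply, smul_eq_mul]
  field_simp [show v a ≠ 0 from ha]
  linear_combination -this

end ProjectiveSets

/-! ### The patch variety under complex linear precision. -/

section Geometry

variable {d : ℕ} {A : Finset (Fin d → ℝ)}

/-- The coordinates of the tautological projection as linear forms. -/
noncomputable def tautForm (A : Finset (Fin d → ℝ)) (j : Fin (d + 1)) : MvPolynomial A ℂ :=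
  ∑ a : A, MvPolynomial.C
    ((Fin.cons 1 (fun i => (((a : Fin d → ℝ) i : ℝ) : ℂ)) : Fin (d + 1) → ℂ) j) *
      MvPolynomial.X a

theorem tautForm_isHomogeneous (j : Fin (d + 1)) : (tautForm A j).IsHomogeneous 1 :=
  MvPolynomial.IsHomogeneous.sum _ _ _ fun _ _ => MvPolynomial.isHomogeneous_C_mul_X _ _

theorem tautLinear_apply (v : A → ℂ) (j : Fin (d + 1)) :
    tautLinear A v j = ∑ a : A, v a *
      (Fin.cons 1 (fun i => (((a : Fin d → ℝ) i : ℝ) : ℂ)) : Fin (d + 1) → ℂ) j := by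
  simp [tautLinear, LinearMap.sum_apply]

theorem eval_tautForm (v : A → ℂ) (j : Fin (d + 1)) :
    MvPolynomial.eval v (tautForm A j) = tautLinear A v j := by
  rw [tautLinear_apply]
  simp [tautForm, mul_comm]

theorem vanishesAt_of_mem_patchVariety {b : A → MvPolynomial (Fin d) ℝ} {n : ℕ}
    {f : MvPolynomial A ℂ} (hf : f.IsHomogeneous n)
    (h : ∀ t : Fin d → ℂ, MvPolynomial.eval (fun a => MvPolynomial.aeval t (b a)) f = 0)
    {y : CP A} (hy : y ∈ patchVariety b) : VanishesAt f y := by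
  refine hy n f hf ?_
  rintro _ ⟨t, ht, rfl⟩
  exact (vanishesAt_mk hf ht).mpr (h t)

theorem mk_mem_patchVariety (b : A → MvPolynomial (Fin d) ℝ) {t : Fin d → ℂ}
    (ht : (fun a => MvPolynomial.aeval t (b a) : A → ℂ) ≠ 0) :
    Projectivization.mk ℂ (fun a => MvPolynomial.aeval t (b a) : A → ℂ) ht ∈ patchVariety b :=
  subset_zariskiClosure _ ⟨t, ht, rfl⟩

/-- Linear precision of the polynomials `b` with weight `q`, over the complex numbers:
`∑ b_a (1, a) = q · (1, t)`. -/
def HasComplexLinearPrecision (b : A → MvPolynomial (Fin d) ℝ) (q : MvPolynomial (Fin d) ℝ) :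
    Prop :=
  ∀ t : Fin d → ℂ, tautLinear A (fun a => MvPolynomial.aeval t (b a)) =
    (MvPolynomial.aeval t q : ℂ) • (Fin.cons 1 t : Fin (d + 1) → ℂ)

/-- A bound for the degrees of the polynomials `b`. -/
def degreeBound (b : A → MvPolynomial (Fin d) ℝ) : ℕ := ∑ a, (b a).totalDegree

/-- The complexified homogenizations of the polynomials `b`, all of the same degree. -/
noncomputable def homogenizedParam (b : A → MvPolynomial (Fin d) ℝ) (a : A) : MvPolynomial (Fin (d + 1)) ℂ :=
  MvPolynomial.homogenizeCons (degreeBound b) (MvPolynomial.map (algebraMap ℝ ℂ) (b a))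

theorem eval_homogenizedParam (b : A → MvPolynomial (Fin d) ℝ) (a : A) (s : ℂ) (t : Fin d → ℂ) :
    MvPolynomial.eval (s • (Fin.cons 1 t : Fin (d + 1) → ℂ)) (homogenizedParam b a) =
      s ^ degreeBound b * MvPolynomial.aeval t (b a) := by
  rw [homogenizedParam, MvPolynomial.eval_homogenizeCons, MvPolynomial.eval_map_ofReal]
  -- Mapping the coefficients cannot enlarge the support, so the degree does not grow.
  exact (Finset.sup_mono (MvPolynomial.support_map_subset _ _)).trans
    (Finset.single_le_sum (f := fun a => (b a).totalDegree) (fun _ _ => Nat.zero_le _)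
      (Finset.mem_univ a))

/-- A point of `Y` outside of the center is recovered from its tautological projection. -/
theorem eq_mk_of_tautLinear_rep_eq {b : A → MvPolynomial (Fin d) ℝ}
    {q : MvPolynomial (Fin d) ℝ} (hb : HasComplexLinearPrecision b q) {y : CP A}
    (hy : y ∈ patchVariety b) {s : ℂ} (hs : s ≠ 0) {t : Fin d → ℂ}
    (hyt : tautLinear A y.rep = s • (Fin.cons 1 t : Fin (d + 1) → ℂ))
    (ht : (fun a => MvPolynomial.aeval t (b a) : A → ℂ) ≠ 0) :
    y = Projectivization.mk ℂ (fun a => MvPolynomial.aeval t (b a) : A → ℂ) ht := by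
  refine eq_mk_of_mul_rep_eq ht fun a c => ?_
  let g (a : A) : MvPolynomial A ℂ := MvPolynomial.aeval (tautForm A) (homogenizedParam b a)
  have hg (a : A) : (g a).IsHomogeneous (degreeBound b) := by
    have := (MvPolynomial.homogenizeCons_isHomogeneous (degreeBound b)
      (MvPolynomial.map (algebraMap ℝ ℂ) (b a))).aeval (tautForm A) tautForm_isHomogeneous
    rwa [one_mul] at this
  have heval (a : A) (v : A → ℂ) (s : ℂ) (t : Fin d → ℂ)
      (hv : tautLinear A v = s • (Fin.cons 1 t : Fin (d + 1) → ℂ)) :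
      MvPolynomial.eval v (g a) = s ^ degreeBound b * MvPolynomial.aeval t (b a) := by
    rw [← eval_homogenizedParam, ← hv]
    simp only [g, MvPolynomial.aeval_def, MvPolynomial.algebraMap_eq, MvPolynomial.eval_eval₂]
    rw [show (fun j => MvPolynomial.eval v (tautForm A j)) = tautLinear A v from
      funext (eval_tautForm v)]
    rw [show (MvPolynomial.eval v).comp MvPolynomial.C = RingHom.id ℂ by ext; simp]
    rfl
  -- At the parameter `t` both products equal `q(t) ^ degreeBound b * b_a(t) * b_c(t)`, so the
  -- difference vanishes on the image and hence at `y`.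
  have hvan := vanishesAt_of_mem_patchVariety
    (f := g a * MvPolynomial.X c - g c * MvPolynomial.X a)
    (((hg a).mul (MvPolynomial.isHomogeneous_X ℂ c)).sub
      ((hg c).mul (MvPolynomial.isHomogeneous_X ℂ a)))
    (fun t => by
      simp only [map_sub, map_mul, MvPolynomial.eval_X, heval _ _ _ _ (hb t)]
      ring) hy
  simp only [VanishesAt, map_sub, map_mul, MvPolynomial.eval_X, heval _ _ _ _ hyt] at hvan
  refine mul_left_cancel₀ (pow_ne_zero (degreeBound b) hs) ?_
  linear_combination hvan

theorem eq_smul_cons_one {v : Fin (d + 1) → ℂ} (hv : v 0 ≠ 0) :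
    v = v 0 • (Fin.cons 1 (fun i => v i.succ / v 0) : Fin (d + 1) → ℂ) := by
  funext j
  refine Fin.cases ?_ (fun i => ?_) j
  · simp
  · simp [mul_div_cancel₀ _ hv]

/-- Pulling forms back along the parametrization turns vanishing on the image into an identity in
the domain `ℂ[t]`. -/
theorem eval_aeval_map (b : A → MvPolynomial (Fin d) ℝ) (f : MvPolynomial A ℂ) (t : Fin d → ℂ) :
    MvPolynomial.eval t
        (MvPolynomial.aeval (fun a => MvPolynomial.map (algebraMap ℝ ℂ) (b a)) f) =
      MvPolynomial.eval (fun a => MvPolynomial.aeval t (b a)) f := by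
  simp only [MvPolynomial.aeval_def, MvPolynomial.algebraMap_eq,
    MvPolynomial.eval_eval₂]
  rw [show (MvPolynomial.eval t).comp MvPolynomial.C = RingHom.id ℂ by ext; simp]
  simp only [MvPolynomial.eval_map]
  rfl

theorem isProjectiveVariety_patchVariety {b : A → MvPolynomial (Fin d) ℝ}
    (hb : (complexImage b).Nonempty) : IsProjectiveVariety (patchVariety b) where
  nonempty := hb.mono (subset_zariskiClosure _)
  closed := isZariskiClosed_zariskiClosure _
  irreducible Z₁ Z₂ h₁ h₂ hY := by
    by_contra! hcon
    obtain ⟨⟨y₁, hy₁, hn₁⟩, ⟨y₂, hy₂, hn₂⟩⟩ :=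
      And.intro (Set.not_subset.mp hcon.1) (Set.not_subset.mp hcon.2)
    rw [← h₁] at hn₁
    rw [← h₂] at hn₂
    simp only [zariskiClosure, Set.mem_ofPred_eq, not_forall] at hn₁ hn₂
    obtain ⟨n₁, f₁, hf₁, hZ₁, hv₁⟩ := hn₁
    obtain ⟨n₂, f₂, hf₂, hZ₂, hv₂⟩ := hn₂
    let B : A → MvPolynomial (Fin d) ℂ := fun a => MvPolynomial.map (algebraMap ℝ ℂ) (b a)
    have hne {n : ℕ} {f : MvPolynomial A ℂ} (hf : f.IsHomogeneous n) {y : CP A}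
        (hy : y ∈ patchVariety b) (hv : ¬ VanishesAt f y) : MvPolynomial.aeval B f ≠ 0 :=
      fun h0 => hv (vanishesAt_of_mem_patchVariety hf
        (fun t => by rw [← eval_aeval_map, h0, map_zero]) hy)
    obtain ⟨_, t₀, ht₀, rfl⟩ := hb
    obtain ⟨a₀, ha₀⟩ := Function.ne_iff.mp ht₀
    have hB : B a₀ ≠ 0 := fun h0 => ha₀ <| by
      rw [← MvPolynomial.eval_map_ofReal]
      exact congrArg (MvPolynomial.eval t₀) h0
    -- The extra factor `B a₀` makes the product vanish also at base points, where there is no image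
    -- point to test.
    refine mul_ne_zero (mul_ne_zero (hne hf₁ hy₁ hv₁) (hne hf₂ hy₂ hv₂)) hB
      (MvPolynomial.funext fun t => ?_)
    rw [map_zero, map_mul, map_mul, eval_aeval_map, eval_aeval_map, MvPolynomial.eval_map_ofReal]
    by_cases ht : (fun a => MvPolynomial.aeval t (b a) : A → ℂ) = 0
    · rw [show (MvPolynomial.aeval t (b a₀) : ℂ) = 0 from congrFun ht a₀, mul_zero]
    · rcases hY (mk_mem_patchVariety b ht) with h | h
      · rw [(vanishesAt_mk hf₁ ht).mp (hZ₁ _ h), zero_mul, zero_mul]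
      · rw [(vanishesAt_mk hf₂ ht).mp (hZ₂ _ h), mul_zero, zero_mul]

theorem exists_aeval_ne_zero {q : MvPolynomial (Fin d) ℝ} (hq : q ≠ 0) :
    ∃ t : Fin d → ℂ, (MvPolynomial.aeval t q : ℂ) ≠ 0 := by
  by_contra! h
  refine hq (MvPolynomial.funext fun x => ?_)
  have := h fun i => (x i : ℂ)
  rw [MvPolynomial.aeval_ofReal] at this
  simpa using this

/-- The zeroth coordinate of linear precision reads `∑ b_a = q`, so base points lie on `q = 0`. -/
theorem HasComplexLinearPrecision.ne_zero {b : A → MvPolynomial (Fin d) ℝ}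
    {q : MvPolynomial (Fin d) ℝ} (hb : HasComplexLinearPrecision b q) {t : Fin d → ℂ}
    (ht : (MvPolynomial.aeval t q : ℂ) ≠ 0) :
    (fun a => MvPolynomial.aeval t (b a) : A → ℂ) ≠ 0 := by
  intro h0
  have := congrFun (hb t) 0
  rw [h0, map_zero] at this
  exact ht (by simpa using this.symm)

theorem HasComplexLinearPrecision.isRationalVariety {b : A → MvPolynomial (Fin d) ℝ}
    {q : MvPolynomial (Fin d) ℝ} (hb : HasComplexLinearPrecision b q) (hq : q ≠ 0) :
    IsRationalVariety d (patchVariety b) := by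
  obtain ⟨t₀, ht₀⟩ := exists_aeval_ne_zero hq
  have hb₀ := hb.ne_zero ht₀
  have hden₀ : ¬ VanishesAt (tautForm A 0) (Projectivization.mk ℂ _ hb₀) := by
    rw [vanishesAt_mk (tautForm_isHomogeneous 0), eval_tautForm, hb t₀]
    simpa using ht₀
  -- The tautological projection, read in the chart where its zeroth coordinate is nonzero.
  let φ : RationalMapToAffine (patchVariety b) d :=
    { degree := 1
      num := fun i => tautForm A i.succ
      den := tautForm A 0
      num_homogeneous := fun i => tautForm_isHomogeneous _
      den_homogeneous := tautForm_isHomogeneous _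
      exists_den_ne_zero := ⟨_, mk_mem_patchVariety b hb₀, hden₀⟩ }
  let γ : RationalMapFromAffine d (patchVariety b) :=
    { coord := fun a => MvPolynomial.map (algebraMap ℝ ℂ) (b a)
      exists_ne_zero := ⟨t₀, by simpa only [MvPolynomial.eval_map_ofReal] using hb₀⟩
      mem := fun t ht => by
        simp only [MvPolynomial.eval_map_ofReal] at ht ⊢
        exact mk_mem_patchVariety b ht }
  have hγ (t : Fin d → ℂ) : t ∈ γ.domain ↔
      (fun a => MvPolynomial.aeval t (b a) : A → ℂ) ≠ 0 := by
    simp only [γ, RationalMapFromAffine.domain, Set.mem_ofPred_eq, MvPolynomial.eval_map_ofReal]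
  have hγv (t : Fin d → ℂ) (ht : t ∈ γ.domain) :
      γ.value t ht = Projectivization.mk ℂ _ ((hγ t).mp ht) := by
    simp only [γ, RationalMapFromAffine.value, MvPolynomial.eval_map_ofReal]
  have hφ (y : CP A) (hy : y ∈ φ.domain) : tautLinear A y.rep 0 ≠ 0 ∧
      tautLinear A y.rep =
        tautLinear A y.rep 0 • (Fin.cons 1 (φ.value y) : Fin (d + 1) → ℂ) := by
    have h0 : tautLinear A y.rep 0 ≠ 0 := by
      have := hy.2
      rwa [VanishesAt, eval_tautForm] at this
    refine ⟨h0, (eq_smul_cons_one h0).trans ?_⟩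
    congr 2
    funext i
    simp only [RationalMapToAffine.value, φ, eval_tautForm]
  have hφγ (t : Fin d → ℂ) (ht : t ∈ γ.domain) (h : γ.value t ht ∈ φ.domain) :
      φ.value (γ.value t ht) = t := by
    obtain ⟨h0, h1⟩ := hφ _ h
    -- The chosen representative is `b(t)` only up to a unit `c`, which cancels in the quotients.
    obtain ⟨c, hc⟩ := Projectivization.exists_smul_eq_mk_rep ℂ _ ((hγ t).mp ht)
    have h2 : tautLinear A (γ.value t ht).rep =
        ((c : ℂ) * MvPolynomial.aeval t q) • (Fin.cons 1 t : Fin (d + 1) → ℂ) := by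
      rw [hγv, ← hc, Units.smul_def, map_smul, hb t, smul_smul]
    have h3 : tautLinear A (γ.value t ht).rep 0 = (c : ℂ) * MvPolynomial.aeval t q := by
      simpa using congrFun h2 0
    rw [h3] at h0 h1
    have h4 := smul_right_injective _ h0 (h1.symm.trans h2)
    exact (Fin.cons_inj.mp h4).2
  have ht₀γ : t₀ ∈ γ.domain := (hγ t₀).mpr hb₀
  have ht₀φ : γ.value t₀ ht₀γ ∈ φ.domain := by
    rw [hγv]
    exact ⟨mk_mem_patchVariety b hb₀, hden₀⟩
  refine ⟨isProjectiveVariety_patchVariety ⟨_, t₀, hb₀, rfl⟩, φ, γ,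
    ⟨_, ht₀φ, by rwa [hφγ _ _ ht₀φ]⟩, fun y hy h => ?_, ⟨t₀, ht₀γ, ht₀φ⟩, hφγ⟩
  obtain ⟨h0, h1⟩ := hφ y hy
  rw [hγv]
  exact (eq_mk_of_tautLinear_rep_eq hb hy.1 h0 h1 _).symm

/-- The tautological projection maps a plane of codimension `d` that contains the center onto a
line. -/
theorem exists_tautLinear_eq_smul {W : Submodule ℂ (A → ℂ)} (hW : center A ≤ W)
    (hdim : Module.finrank ℂ W + d = A.card) {w : A → ℂ} (hw : w ∈ W) (hwc : w ∉ center A)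
    {y : A → ℂ} (hy : y ∈ W) : ∃ k : ℂ, tautLinear A y = k • tautLinear A w := by
  have hrank := (tautLinear A).finrank_range_add_finrank_ker
  have hle : Module.finrank ℂ (LinearMap.range (tautLinear A)) ≤ d + 1 := by
    simpa using Submodule.finrank_le (LinearMap.range (tautLinear A))
  have hrankW := ((tautLinear A).domRestrict W).finrank_range_add_finrank_ker
  have hker : Module.finrank ℂ (LinearMap.ker ((tautLinear A).domRestrict W)) =
      Module.finrank ℂ (LinearMap.ker (tautLinear A)) := by
    rw [LinearMap.ker_domRestrict]
    exact (Submodule.comapSubtypeEquivOfLe hW).finrank_eq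
  rw [Module.finrank_fintype_fun_eq_card, Fintype.card_coe] at hrank
  -- Since the range has dimension at most `d + 1`, the kernel has dimension at least `A.card - d -
  -- 1`, that is, `finrank W - 1`.
  have hone : Module.finrank ℂ (LinearMap.range ((tautLinear A).domRestrict W)) ≤ 1 := by
    omega
  obtain ⟨v, hv⟩ := finrank_le_one_iff.mp hone
  obtain ⟨k, hk⟩ := hv ⟨_, ⟨w, hw⟩, rfl⟩
  obtain ⟨l, hl⟩ := hv ⟨_, ⟨y, hy⟩, rfl⟩
  have hk' : k • (v : Fin (d + 1) → ℂ) = tautLinear A w := congrArg Subtype.val hk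
  have hl' : l • (v : Fin (d + 1) → ℂ) = tautLinear A y := congrArg Subtype.val hl
  have hk0 : k ≠ 0 := by
    rintro rfl
    exact hwc (by rw [center, LinearMap.mem_ker, ← hk', zero_smul])
  exact ⟨l / k, by rw [← hk', ← hl', smul_smul, div_mul_cancel₀ _ hk0]⟩

theorem HasComplexLinearPrecision.forAlmostAllPlanes {b : A → MvPolynomial (Fin d) ℝ}
    {q : MvPolynomial (Fin d) ℝ} (hb : HasComplexLinearPrecision b q) (hq : q ≠ 0) :
    ForAlmostAllPlanes A (fun W =>
      {y : CP A | y ∈ patchVariety b ∧ y.submodule ≤ W ∧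
        ¬ y.submodule ≤ center A}.Subsingleton) := by
  obtain ⟨t₀, ht₀⟩ := exists_aeval_ne_zero hq
  obtain ⟨a, ha⟩ := Function.ne_iff.mp (hb.ne_zero ht₀)
  -- The factor `X 0` puts the projected point in the affine chart; the other forces `b_a(t) ≠ 0`
  -- there, so `t` is not a base point.
  refine ⟨1 + degreeBound b, MvPolynomial.X 0 * homogenizedParam b a,
    (MvPolynomial.isHomogeneous_X ℂ 0).mul (MvPolynomial.homogenizeCons_isHomogeneous _ _),
    fun h0 => ?_, ?_⟩
  · have := congrArg (MvPolynomial.eval ((1 : ℂ) • (Fin.cons 1 t₀ : Fin (d + 1) → ℂ))) h0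
    rw [map_mul, eval_homogenizedParam] at this
    simp at this
    exact ha this
  · rintro W hW hdim ⟨w, hw, hwc, hne⟩
    rw [map_mul, MvPolynomial.eval_X] at hne
    have hw0 := left_ne_zero_of_mul hne
    have hwt := eq_smul_cons_one hw0
    set s := tautLinear A w 0
    set t : Fin d → ℂ := fun i => tautLinear A w i.succ / s
    have hne' := right_ne_zero_of_mul hne
    rw [hwt, eval_homogenizedParam] at hne'
    have ht : (fun a => MvPolynomial.aeval t (b a) : A → ℂ) ≠ 0 :=
      Function.ne_iff.mpr ⟨a, right_ne_zero_of_mul hne'⟩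
    have key (y : CP A) (hy : y ∈ patchVariety b) (hyW : y.submodule ≤ W)
        (hyc : ¬ y.submodule ≤ center A) : y = Projectivization.mk ℂ _ ht := by
      rw [y.submodule_eq, Submodule.span_singleton_le_iff_mem] at hyW hyc
      obtain ⟨k, hk⟩ := exists_tautLinear_eq_smul hW hdim hw hwc hyW
      have hk0 : k ≠ 0 := by
        rintro rfl
        exact hyc (by rw [center, LinearMap.mem_ker, hk, zero_smul])
      refine eq_mk_of_tautLinear_rep_eq hb hy (mul_ne_zero hk0 hw0) ?_ ht
      rw [hk, mul_smul]
      exact congrArg _ hwt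
    exact fun y hy z hz => (key y hy.1 hy.2.1 hy.2.2).trans (key z hz.1 hz.2.1 hz.2.2).symm

end Geometry

/-! ### From real blending functions to polynomial identities. -/

namespace Patch

variable {d : ℕ} {A : Finset (Fin d → ℝ)}

theorem sum_blend_pos (P : Patch A) (x : DomainPolytope A) : 0 < ∑ c, P.blend c x := by
  obtain ⟨a, ha⟩ := P.no_base_points x
  exact Finset.sum_pos' (fun c _ => P.nonneg c x)
    ⟨a, Finset.mem_univ a, (P.nonneg a x).lt_of_ne' ha⟩

theorem sum_normalized (P : Patch A) (x : DomainPolytope A) : ∑ a, P.normalized a x = 1 := by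
  simp only [normalized]
  rw [← Finset.sum_div, div_self (P.sum_blend_pos x).ne']

theorem continuous_normalized (P : Patch A) (a : A) : Continuous (P.normalized a) :=
  (P.continuous_blend a).div (continuous_finsetSum _ fun c _ => P.continuous_blend c)
    fun x => (P.sum_blend_pos x).ne'

theorem HasLinearPrecision.sum_normalized_mul {P : Patch A} (hP : P.HasLinearPrecision)
    (x : DomainPolytope A) (i : Fin d) :
    ∑ a : A, P.normalized a x * (a : Fin d → ℝ) i = (x : Fin d → ℝ) i := by
  have := hP (LinearMap.proj (R := ℝ) (φ := fun _ : Fin d => ℝ) i).toAffineMap x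
  simpa [toMap] using this.symm

/-- Clearing denominators of rational normalized blending functions. -/
theorem exists_common_denominator {f : A → DomainPolytope A → ℝ}
    (hf : ∀ a, IsRationalFunction (f a)) :
    ∃ (b : A → MvPolynomial (Fin d) ℝ) (q : MvPolynomial (Fin d) ℝ), q ≠ 0 ∧
      ∀ (a : A) (x : DomainPolytope A), MvPolynomial.eval (x : Fin d → ℝ) (b a) =
        MvPolynomial.eval (x : Fin d → ℝ) q * f a x := by
  classical
  choose p q hq hpq using hf
  refine ⟨fun a => (∏ c ∈ Finset.univ.erase a, q c) * p a, ∏ c, q c,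
    Finset.prod_ne_zero_iff.mpr fun a _ => hq a, fun a x => ?_⟩
  rw [map_mul, ← hpq a x, ← Finset.prod_erase_mul _ _ (Finset.mem_univ a), map_mul, mul_assoc]

/-- The points of `Δ` where a nonzero polynomial does not vanish are dense in `Δ`. -/
theorem dense_eval_ne_zero (P : Patch A) {q : MvPolynomial (Fin d) ℝ} (hq : q ≠ 0) :
    Dense {x : DomainPolytope A | MvPolynomial.eval (x : Fin d → ℝ) q ≠ 0} := by
  refine dense_iff_inter_open.mpr ?_
  rintro _ ⟨V, hV, rfl⟩ ⟨x, hx⟩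
  -- A convex set with interior lies in the closure of its interior, so every nonempty relatively
  -- open subset of `Δ` contains a nonempty open subset of `ℝ^d`.
  have hcl : (x : Fin d → ℝ) ∈ closure (interior (DomainPolytope A)) := by
    rw [(convex_convexHull ℝ _).closure_interior_eq_closure_of_nonempty_interior P.full_dim]
    exact subset_closure x.2
  have hne := mem_closure_iff.mp hcl V hV hx
  by_contra! hcon
  refine hq (MvPolynomial.eq_zero_of_eval_eq_zero_of_isOpen (hV.inter isOpen_interior) hne
    fun z hz => ?_)
  by_contra hz0
  have : (⟨z, interior_subset hz.2⟩ : DomainPolytope A) ∈ (∅ : Set (DomainPolytope A)) := by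
    rw [← hcon]
    exact ⟨hz.1, hz0⟩
  exact this

/-- The homogeneous polynomials vanishing on the image of a polynomial parametrization are those
that vanish at the values of the normalized blending functions. -/
theorem vanishesAt_complexImage_iff (P : Patch A) {b : A → MvPolynomial (Fin d) ℝ}
    (hb : P.IsPolynomialParametrization b) {n : ℕ} {f : MvPolynomial A ℂ}
    (hf : f.IsHomogeneous n) : (∀ y ∈ complexImage b, VanishesAt f y) ↔
      ∀ x, MvPolynomial.eval (fun a => (P.normalized a x : ℂ)) f = 0 := by
  obtain ⟨ψ, q, hq, hbq⟩ := hb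
  have hvec (x : DomainPolytope A) :
      (fun a => MvPolynomial.aeval (fun i => ((x : Fin d → ℝ) i : ℂ)) (b a) : A → ℂ) =
        ((MvPolynomial.eval (x : Fin d → ℝ) q : ℝ) : ℂ) •
          fun a => (P.normalized a (ψ x) : ℂ) := by
    funext a
    rw [MvPolynomial.aeval_ofReal, hbq a x, Complex.ofReal_mul]
    rfl
  constructor
  · intro h
    -- The factor `q ^ n` can be cancelled only where `q ≠ 0`; density and continuity cover the rest
    -- of `Δ`.
    have hcont : Continuous fun x : DomainPolytope A =>
        MvPolynomial.eval (fun a => (P.normalized a (ψ x) : ℂ)) f :=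
      (MvPolynomial.continuous_eval f).comp (continuous_pi fun a =>
        Complex.continuous_ofReal.comp ((P.continuous_normalized a).comp ψ.continuous))
    have hzero : (fun x : DomainPolytope A =>
        MvPolynomial.eval (fun a => (P.normalized a (ψ x) : ℂ)) f) = fun _ => 0 := by
      refine hcont.ext_on (P.dense_eval_ne_zero hq) continuous_const fun x hx => ?_
      have hx' : ((MvPolynomial.eval (x : Fin d → ℝ) q : ℝ) : ℂ) ≠ 0 :=
        Complex.ofReal_ne_zero.mpr hx
      have hne : (fun a => MvPolynomial.aeval (fun i => ((x : Fin d → ℝ) i : ℂ)) (b a) :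
          A → ℂ) ≠ 0 := by
        rw [hvec x]
        refine smul_ne_zero hx' fun h0 => one_ne_zero (α := ℝ) ?_
        rw [← P.sum_normalized (ψ x)]
        exact Finset.sum_eq_zero fun a _ => Complex.ofReal_eq_zero.mp (congrFun h0 a)
      have := (vanishesAt_mk hf hne).mp (h _ ⟨_, hne, rfl⟩)
      rw [hvec x, hf.eval_smul] at this
      exact (mul_eq_zero.mp this).resolve_left (pow_ne_zero n hx')
    intro x
    simpa using congrFun hzero (ψ.symm x)
  · rintro h _ ⟨t, ht, rfl⟩
    rw [vanishesAt_mk hf ht]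
    -- The pullback of `f` vanishes at the real points of the interior of `Δ`, hence identically on
    -- `ℂ^d`.
    have hzero : MvPolynomial.aeval
        (fun a => MvPolynomial.map (algebraMap ℝ ℂ) (b a)) f = 0 := by
      refine MvPolynomial.eq_zero_of_eval_ofReal_eq_zero isOpen_interior P.full_dim
        fun x hx => ?_
      rw [eval_aeval_map, hvec ⟨x, interior_subset hx⟩, hf.eval_smul, h, mul_zero]
    rw [← eval_aeval_map, hzero, map_zero]

/-- All polynomial parametrizations of a patch define the same variety. -/
theorem patchVariety_eq (P : Patch A) {b c : A → MvPolynomial (Fin d) ℝ}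
    (hb : P.IsPolynomialParametrization b) (hc : P.IsPolynomialParametrization c) :
    patchVariety b = patchVariety c := by
  ext y
  refine forall_congr' fun n => forall_congr' fun f => forall_congr' fun hf => ?_
  -- The criterion mentions neither the polynomials nor `ψ` and `q`, so both sides become the same.
  rw [P.vanishesAt_complexImage_iff hb hf, P.vanishesAt_complexImage_iff hc hf]

/-- Linear precision on `Δ` extends to an identity of polynomials. -/
theorem HasLinearPrecision.hasComplexLinearPrecision {P : Patch A} (hP : P.HasLinearPrecision)
    {b : A → MvPolynomial (Fin d) ℝ} {q : MvPolynomial (Fin d) ℝ}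
    (hb : ∀ (a : A) (x : DomainPolytope A), MvPolynomial.eval (x : Fin d → ℝ) (b a) =
      MvPolynomial.eval (x : Fin d → ℝ) q * P.normalized a x) :
    HasComplexLinearPrecision b q := by
  have hext {p r : MvPolynomial (Fin d) ℝ} (h : ∀ x : DomainPolytope A,
      MvPolynomial.eval (x : Fin d → ℝ) p = MvPolynomial.eval (x : Fin d → ℝ) r) : p = r := by
    refine sub_eq_zero.mp (MvPolynomial.eq_zero_of_eval_eq_zero_of_isOpen isOpen_interior
      P.full_dim fun x hx => ?_)
    rw [map_sub, h ⟨x, interior_subset hx⟩, sub_self]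
  have hsum : ∑ a, b a = q := hext fun x => by
    simp only [map_sum, hb, ← Finset.mul_sum, P.sum_normalized, mul_one]
  have hcoord (i : Fin d) : ∑ a : A, b a * MvPolynomial.C ((a : Fin d → ℝ) i) =
      q * MvPolynomial.X i := hext fun x => by
    simp only [map_sum, map_mul, hb, MvPolynomial.eval_C, MvPolynomial.eval_X, mul_assoc,
      ← Finset.mul_sum, hP.sum_normalized_mul]
  intro t
  funext j
  rw [tautLinear_apply]
  refine Fin.cases ?_ (fun i => ?_) j
  · simp [← hsum]
  · simpa using congrArg (MvPolynomial.aeval t) (hcoord i)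

end Patch

theorem theorem2p3 {d : ℕ} {A : Finset (Fin d → ℝ)} (P : Patch A)
    (hP : P.HasRationalLinearPrecision) :
    (∃ b : A → MvPolynomial (Fin d) ℝ, P.IsPolynomialParametrization b) ∧
      ∀ b : A → MvPolynomial (Fin d) ℝ, P.IsPolynomialParametrization b →
        IsRationalVariety d (patchVariety b) ∧
        ForAlmostAllPlanes A (fun W =>
          {y : CP A | y ∈ patchVariety b ∧ y.submodule ≤ W ∧
            ¬ y.submodule ≤ center A}.Subsingleton) := by
  obtain ⟨-, ψ, hlin, hrat⟩ := hP
  obtain ⟨c, q, hq, hc⟩ := Patch.exists_common_denominator hrat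
  have hcP : P.IsPolynomialParametrization c := ⟨ψ, q, hq, hc⟩
  have hcl := hlin.hasComplexLinearPrecision hc
  refine ⟨⟨c, hcP⟩, fun b hb => ?_⟩
  -- `b` may come from a reparametrization without linear precision; only `c` is known to satisfy
  -- the identity.
  rw [P.patchVariety_eq hb hcP]
  exact ⟨hcl.isRationalVariety hq, hcl.forAlmostAllPlanes hq⟩
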